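/- Let $p$ be an odd prime. A $p$-adic field is a finite extension of $\mathbb{Q}_p$. Let $K$ be a $p$-adic field with ramification index $e$ over $\mathbb{Q}_p$, and let $L/K$ be an extension of degree $p$ which is typical, that is, $L$ is not generated over $K$ by a $p$-th root of a uniformizer of $K$. Let $\widetilde{L}$ be the normal closure of $L/K$ and assume that $\widetilde{L}/K$ is totally ramified. Put $r=[\widetilde{L}:L]$ and let $t$ be the ramification jump of $\widetilde{L}/K$, that is, the integer $t$ such that the ramification groups (in the lower numbering) of $G=\mathrm{Gal}(\widetilde{L}/K)$ satisfy $G_t\cong C_p$ and $G_{t+1}=\{1\}$. Let $c$ be the remainder of $t$ modulo $r$, let $$\ell=\frac{pc(r-1)+t}{r},$$ let $a$ be the remainder of $\ell$ modulo $p$, and let $\nu_{p-1}=\left\lfloor\frac{a+(p-1)\ell}{p}\right\rfloor$. Then $\ell$ is an integer, $$\nu_{p-1}\leq e+\frac{p-1}{r}(r-1)c,$$ and equality holds if and only if $t\geq\frac{rpe}{p-1}-r$. -/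

import Mathlib

open Module IsLocalRing

noncomputable section

namespace PadicExt

/-- The ring of integers of a `p`-adic field `F` (a finite extension of `ℚ_p`): the valuation ring
`{x | |x| ≤ 1}` of the unique extension of the `p`-adic absolute value to `F`, which in Mathlib is
the spectral norm. -/
def ringOfIntegers (p : ℕ) [Fact p.Prime] (F : Type*) [Field F] [Algebra ℚ_[p] F]
    [FiniteDimensional ℚ_[p] F] : ValuationSubring F where
  carrier := {x | spectralNorm ℚ_[p] F x ≤ 1}
  mul_mem' {x y} hx hy := by
    have h := map_mul (spectralMulAlgNorm ℚ_[p] F) x y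
    simp only [spectralMulAlgNorm_def] at h
    simp only [Set.mem_ofPred_eq] at hx hy ⊢
    rw [h]
    exact mul_le_one₀ hx (spectralNorm_nonneg y) hy
  one_mem' := by
    simp only [Set.mem_ofPred_eq]
    exact (spectralNorm_one (K := ℚ_[p]) (L := F)).le
  add_mem' {x y} hx hy :=
    (isNonarchimedean_spectralNorm (K := ℚ_[p]) (L := F) x y).trans (max_le hx hy)
  zero_mem' := by
    simp only [Set.mem_ofPred_eq]
    rw [spectralNorm_zero]
    exact zero_le_one
  neg_mem' {x} hx := by
    simp only [Set.mem_ofPred_eq] at hx ⊢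
    rwa [spectralNorm_neg (Algebra.IsAlgebraic.isAlgebraic x)]
  mem_or_inv_mem' x := by
    by_cases hx : spectralNorm ℚ_[p] F x ≤ 1
    · exact Or.inl hx
    · right
      have h := map_inv₀ (spectralMulAlgNorm ℚ_[p] F) x
      simp only [spectralMulAlgNorm_def] at h
      change spectralNorm ℚ_[p] F x⁻¹ ≤ 1
      rw [h]
      exact inv_le_one_of_one_le₀ (not_le.mp hx).le

theorem mem_ringOfIntegers (p : ℕ) [Fact p.Prime] (F : Type*) [Field F] [Algebra ℚ_[p] F]
    [FiniteDimensional ℚ_[p] F] (x : F) :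
    x ∈ ringOfIntegers p F ↔ spectralNorm ℚ_[p] F x ≤ 1 := Iff.rfl

/-- The inclusion `𝒪_K → 𝒪_F` for an extension `F / K` of `p`-adic fields. -/
def integersMap (p : ℕ) [Fact p.Prime] (K F : Type*) [Field K] [Field F]
    [Algebra ℚ_[p] K] [FiniteDimensional ℚ_[p] K] [Algebra ℚ_[p] F] [FiniteDimensional ℚ_[p] F]
    [Algebra K F] [IsScalarTower ℚ_[p] K F] :
    ringOfIntegers p K →+* ringOfIntegers p F :=
  (algebraMap K F).restrict (ringOfIntegers p K) (ringOfIntegers p F) fun x hx => by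
    rw [mem_ringOfIntegers] at hx ⊢
    rwa [← spectralNorm.eq_of_tower]

/-- The ramification index `e(F/K)` of an extension of `p`-adic fields: the largest `n` such that
`𝔭_K 𝒪_F ⊆ 𝔭_F ^ n`. -/
def ramificationIndex (p : ℕ) [Fact p.Prime] (K F : Type*) [Field K] [Field F]
    [Algebra ℚ_[p] K] [FiniteDimensional ℚ_[p] K] [Algebra ℚ_[p] F] [FiniteDimensional ℚ_[p] F]
    [Algebra K F] [IsScalarTower ℚ_[p] K F] : ℕ :=
  letI : Algebra (ringOfIntegers p K) (ringOfIntegers p F) := (integersMap p K F).toAlgebra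
  Ideal.ramificationIdx' (maximalIdeal (ringOfIntegers p K)) (maximalIdeal (ringOfIntegers p F))

/-- `F / K` is totally ramified. -/
def IsTotallyRamified (p : ℕ) [Fact p.Prime] (K F : Type*) [Field K] [Field F]
    [Algebra ℚ_[p] K] [FiniteDimensional ℚ_[p] K] [Algebra ℚ_[p] F] [FiniteDimensional ℚ_[p] F]
    [Algebra K F] [IsScalarTower ℚ_[p] K F] : Prop :=
  ramificationIndex p K F = finrank K F

/-- `ϖ` is a uniformizer of the `p`-adic field `K`. -/
def IsUniformizer (p : ℕ) [Fact p.Prime] (K : Type*) [Field K] [Algebra ℚ_[p] K]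
    [FiniteDimensional ℚ_[p] K] (ϖ : ringOfIntegers p K) : Prop :=
  maximalIdeal (ringOfIntegers p K) = Ideal.span {ϖ}

/-- A degree `p` extension `L / K` of `p`-adic fields is typical if it is not generated by a
`p`-th root of a uniformizer of `K`. -/
def IsTypical (p : ℕ) [Fact p.Prime] (K L : Type*) [Field K] [Field L] [Algebra ℚ_[p] K]
    [FiniteDimensional ℚ_[p] K] [Algebra K L] : Prop :=
  finrank K L = p ∧
    ¬ ∃ (ϖ : ringOfIntegers p K) (x : L), IsUniformizer p K ϖ ∧
      x ^ p = algebraMap K L (ϖ : K) ∧ IntermediateField.adjoin K {x} = ⊤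

/-- The action of `Gal(F/K)` on `𝒪_F`. -/
instance galoisAction (p : ℕ) [Fact p.Prime] (K F : Type*) [Field K] [Field F]
    [Algebra ℚ_[p] K] [Algebra ℚ_[p] F] [FiniteDimensional ℚ_[p] F]
    [Algebra K F] [IsScalarTower ℚ_[p] K F] :
    MulSemiringAction (F ≃ₐ[K] F) (ringOfIntegers p F) where
  smul σ x := ⟨σ x, by
    have hx := x.2
    rw [mem_ringOfIntegers] at hx ⊢
    rwa [spectralNorm_eq_of_equiv (σ.restrictScalars ℚ_[p]) (x : F)] at hx⟩
  one_smul _ := rfl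
  mul_smul _ _ _ := rfl
  smul_zero σ := Subtype.ext (map_zero σ)
  smul_add σ x y := Subtype.ext (map_add σ (x : F) y)
  smul_one σ := Subtype.ext (map_one σ)
  smul_mul σ x y := Subtype.ext (map_mul σ (x : F) y)

/-- The ramification group `G_i`, `i ≥ -1`, of `F / K` in the lower numbering:
the `σ` with `σ x - x ∈ 𝔭_F ^ (i + 1)` for all `x ∈ 𝒪_F`. (For `i < -1` this is the whole group.) -/
def ramificationGroup (p : ℕ) [Fact p.Prime] (K F : Type*) [Field K] [Field F]
    [Algebra ℚ_[p] K] [Algebra ℚ_[p] F] [FiniteDimensional ℚ_[p] F]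
    [Algebra K F] [IsScalarTower ℚ_[p] K F] (i : ℤ) : Subgroup (F ≃ₐ[K] F) :=
  (Submodule.toAddSubgroup (maximalIdeal (ringOfIntegers p F) ^ (i + 1).toNat)).inertia
    (F ≃ₐ[K] F)

/-- `t` is the ramification jump of `F / K`: `G_t ≅ C_p` and `G_{t+1} = 1`. -/
def IsRamificationJump (p : ℕ) [Fact p.Prime] (K F : Type*) [Field K] [Field F]
    [Algebra ℚ_[p] K] [Algebra ℚ_[p] F] [FiniteDimensional ℚ_[p] F]
    [Algebra K F] [IsScalarTower ℚ_[p] K F] (t : ℤ) : Prop :=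
  Nonempty (ramificationGroup p K F t ≃* Multiplicative (ZMod p)) ∧
    ramificationGroup p K F (t + 1) = ⊥

/-- `ν_i = ⌊(a + i ℓ) / p⌋`, where `a` is the remainder of `ℓ` modulo `p`. -/
def nu (p : ℕ) (ℓ : ℤ) (i : ℕ) : ℤ :=
  ⌊(((ℓ % p : ℤ) : ℚ) + (i : ℚ) * (ℓ : ℚ)) / (p : ℚ)⌋

end PadicExt

end

/-! The statement reduces to integer arithmetic given two facts: `r ∣ p - 1`, and `(p - 1) * t ≤ p *
r * e`.

Divisibility (`finrank_dvd_pred_of_normal_subgroup`): the ramification group `G_t` is normal of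
order `p`, and `H = Gal(Lt/L)` has index `p` and contains no nontrivial normal subgroup of `G`.
Hence `G = G_t H`, and `H` acts faithfully on `G_t ≅ C_p` by conjugation, so `|H| = r` divides `|Aut
C_p| = p - 1`.

Bound (`mul_le_addVal_natCast`): for `σ ≠ 1` in `G_t`, the operator `δ = σ - 1` raises valuations by
at least `t`, and expanding `(1 + δ)^p = 1` forces `(p - 1) * t ≤ v(p)`. Total ramification gives
`v(p) = p * r * e`.

Arithmetic (`floor_bound_of_dvd`): with `p = r * d + 1`, the inequality on `nu` becomes `d * t ≤ p *
e`, which is the bound, and equality becomes `p * e ≤ d * t + d * r`. -/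

namespace PadicExt

/-! ### Valuations in a discrete valuation ring. -/

section DiscreteValuationRing

variable {R : Type*} [CommRing R] [IsDomain R] [IsDiscreteValuationRing R]

theorem mem_maximalIdeal_pow_iff_le_addVal (x : R) (n : ℕ) :
    x ∈ maximalIdeal R ^ n ↔ (n : ℕ∞) ≤ IsDiscreteValuationRing.addVal R x := by
  obtain ⟨ϖ, hϖ⟩ := IsDiscreteValuationRing.exists_irreducible R
  rw [hϖ.maximalIdeal_eq, Ideal.span_singleton_pow, Ideal.mem_span_singleton,
    ← IsDiscreteValuationRing.addVal_le_iff_dvd, IsDiscreteValuationRing.addVal_pow,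
    IsDiscreteValuationRing.addVal_uniformizer hϖ, nsmul_one]

theorem addVal_map_eq_mul {S : Type*} [CommRing S] [IsDomain S] [IsDiscreteValuationRing S]
    (f : R →+* S) {ϖ : R} (hϖ : Irreducible ϖ) {x : R} (hx : x ≠ 0) :
    IsDiscreteValuationRing.addVal S (f x) =
      IsDiscreteValuationRing.addVal R x * IsDiscreteValuationRing.addVal S (f ϖ) := by
  obtain ⟨n, u, rfl⟩ := IsDiscreteValuationRing.eq_unit_mul_pow_irreducible hx hϖ
  rw [IsDiscreteValuationRing.addVal_def' u hϖ, map_mul, map_pow,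
    IsDiscreteValuationRing.addVal_mul, IsDiscreteValuationRing.addVal_pow,
    IsDiscreteValuationRing.addVal_eq_zero_iff.mpr (u.isUnit.map f), zero_add, nsmul_eq_mul]

end DiscreteValuationRing

/-! ### Automorphisms of a discrete valuation ring and the bound on their break. -/

section Automorphism

theorem smul_mem_maximalIdeal_pow {G R : Type*} [CommRing R] [IsLocalRing R] [Group G]
    [MulSemiringAction G R] (g : G) {n : ℕ} {x : R} (hx : x ∈ maximalIdeal R ^ n) :
    g • x ∈ maximalIdeal R ^ n := by
  have h : maximalIdeal R ≤ (maximalIdeal R).comap (MulSemiringAction.toRingHom G R g) := by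
    intro y hy
    rw [Ideal.mem_comap, mem_maximalIdeal, mem_nonunits_iff]
    intro hu
    have := hu.map (MulSemiringAction.toRingHom G R g⁻¹)
    simp only [MulSemiringAction.toRingHom_apply, inv_smul_smul] at this
    exact hy this
  have h2 := (Ideal.pow_right_mono h n).trans (Ideal.le_comap_pow _ n)
  exact h2 hx

variable {G R : Type*} [CommRing R] [IsLocalRing R] [Group G] [MulSemiringAction G R]

/-- The twisted Leibniz rule `δ(ab) = δ(a) g(b) + a δ(b)` for `δ = g - 1` lets each further factor
from the maximal ideal contribute one to the exponent. -/
theorem smul_sub_mem_maximalIdeal_pow_add {t : ℕ} {g : G}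
    (hg : ∀ x : R, g • x - x ∈ maximalIdeal R ^ (t + 1)) (n : ℕ) {x : R}
    (hx : x ∈ maximalIdeal R ^ n) : g • x - x ∈ maximalIdeal R ^ (n + t) := by
  induction n generalizing x with
  | zero => exact Ideal.pow_le_pow_right (by omega) (hg x)
  | succ n ih =>
    rw [pow_succ] at hx
    induction hx using Submodule.mul_induction_on' with
    | mem_mul_mem a ha b hb =>
      have : g • (a * b) - a * b = (g • a - a) * (g • b) + a * (g • b - b) := by
        rw [smul_mul']; ring
      rw [this]
      refine add_mem ?_ ?_
      · have h1 := ih ha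
        have h2 := smul_mem_maximalIdeal_pow g (n := 1) ((pow_one (maximalIdeal R)).symm ▸ hb)
        have := Ideal.mul_mem_mul h1 h2
        rwa [← pow_add, show n + t + 1 = n + 1 + t by omega] at this
      · have := Ideal.mul_mem_mul ha (hg b)
        rwa [← pow_add, show n + (t + 1) = n + 1 + t by omega] at this
    | add a _ b _ ha hb =>
      have : g • (a + b) - (a + b) = (g • a - a) + (g • b - b) := by
        rw [smul_add]; ring
      rw [this]
      exact add_mem ha hb

/-- The bound on the break of an automorphism of prime order. -/
theorem mul_le_addVal_natCast {G R : Type*} [CommRing R] [IsDomain R] [IsDiscreteValuationRing R]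
    [Group G] [MulSemiringAction G R] {p : ℕ} (hp : p.Prime) {t : ℕ} (ht : 0 < t) {g : G}
    (hgp : g ^ p = 1) (hg : ∀ x : R, g • x - x ∈ maximalIdeal R ^ (t + 1))
    (hg1 : ∃ x : R, g • x ≠ x) :
    (((p - 1) * t : ℕ) : ℕ∞) ≤ IsDiscreteValuationRing.addVal R (p : R) := by
  by_contra! hlt
  obtain ⟨E, hE⟩ := ENat.ne_top_iff_exists.mp hlt.ne_top
  rw [← hE, Nat.cast_lt] at hlt
  obtain ⟨x, hx⟩ := hg1
  set γ : Module.End ℤ R := (DistribSMul.toAddMonoidHom R g).toIntLinearMap with hγ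
  set δ : Module.End ℤ R := γ - 1 with hδ
  have hδa (y : R) : δ y = g • y - y := rfl
  have hpow (k : ℕ) (y : R) : (γ ^ k) y = g ^ k • y := by
    induction k generalizing y with
    | zero => simp
    | succ k ih => rw [pow_succ, pow_succ, mul_smul, Module.End.mul_apply, ih]; rfl
  have hone : (δ + 1) ^ p = 1 := by
    ext y
    rw [hδ, sub_add_cancel, hpow, hgp, one_smul, Module.End.one_apply]
  rw [(Commute.one_right δ).add_pow] at hone
  -- Every surviving term of `((1 + δ)^p - 1) x = 0` contains `δ`, so the relation can be read as
  -- one on `y = δ x`, with leading term `p * y`.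
  set y := δ x with hy
  have hy0 : y ≠ 0 := by rw [hy, hδa]; exact sub_ne_zero.mpr hx
  obtain ⟨n, hn⟩ := ENat.ne_top_iff_exists.mp
    (IsDiscreteValuationRing.addVal_eq_top_iff.not.mpr hy0)
  have hmem (k : ℕ) : (δ ^ k) y ∈ maximalIdeal R ^ (n + k * t) := by
    induction k with
    | zero => simpa [mem_maximalIdeal_pow_iff_le_addVal] using hn.le
    | succ k ih =>
      rw [pow_succ']
      have := smul_sub_mem_maximalIdeal_pow_add hg _ ih
      rw [Module.End.mul_apply, hδa]
      convert this using 2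
      ring
  have hsum : ∑ k ∈ Finset.range p, (p.choose (k + 1) : R) * (δ ^ k) y = 0 := by
    have := congr($hone x)
    rw [Finset.sum_range_succ', LinearMap.add_apply, LinearMap.sum_apply] at this
    simp only [one_pow, mul_one, pow_zero, Nat.choose_zero_right, Nat.cast_one,
      Module.End.one_apply, add_eq_right] at this
    rw [← this]
    refine Finset.sum_congr rfl fun k _ => ?_
    rw [← (Nat.cast_commute (p.choose (k + 1)) (δ ^ (k + 1))).eq, Module.End.mul_apply,
      pow_succ, Module.End.mul_apply, Module.End.natCast_apply, nsmul_eq_mul]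
  have hpE : (p : R) ∈ maximalIdeal R ^ E := by
    rw [mem_maximalIdeal_pow_iff_le_addVal, hE]
  -- The valuation of `p * y` is exactly `E + n`, so this is the contradiction. The top term
  -- `δ^(p-1) y` has valuation at least `n + (p - 1) * t > n + E`; the middle ones gain `E` from the
  -- binomial coefficient and a positive multiple of `t` from `δ`.
  have hfirst : (p : R) * y ∈ maximalIdeal R ^ (E + n + 1) := by
    obtain ⟨q, rfl⟩ := Nat.exists_eq_succ_of_ne_zero hp.ne_zero
    rw [Finset.sum_range_succ'] at hsum
    simp only [zero_add, Nat.choose_one_right, pow_zero, Module.End.one_apply] at hsum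
    rw [eq_neg_of_add_eq_zero_right hsum]
    refine neg_mem (sum_mem fun k hk => ?_)
    rw [Finset.mem_range] at hk
    obtain hk' | hk' := eq_or_lt_of_le (Nat.succ_le_of_lt hk)
    · refine Ideal.mul_mem_left _ _ (Ideal.pow_le_pow_right ?_ (hmem (k + 1)))
      rw [Nat.succ_sub_one] at hlt
      rw [← Nat.succ_eq_add_one k, hk']
      omega
    · obtain ⟨m, hm⟩ := hp.dvd_choose_self (k := k + 1 + 1) (by omega) (by omega)
      rw [hm, Nat.cast_mul, mul_assoc]
      have := Ideal.mul_mem_mul hpE (Ideal.mul_mem_left _ (m : R) (hmem (k + 1)))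
      rw [← pow_add] at this
      refine Ideal.pow_le_pow_right ?_ this
      nlinarith
  rw [mem_maximalIdeal_pow_iff_le_addVal, IsDiscreteValuationRing.addVal_mul, ← hE, ← hn] at hfirst
  norm_cast at hfirst
  omega

end Automorphism

/-! ### Floors and divisibility. -/

section Arithmetic

theorem floor_bound_of_dvd {p r e : ℕ} {t c ℓ : ℤ} (hp : 1 < p) (hr : 0 < r) (hrp : r ∣ p - 1)
    (ht : ((p : ℤ) - 1) * t ≤ p * (r * e)) (hc : c = t % (r : ℤ))
    (hℓ : ℓ = ((p : ℤ) * c * ((r : ℤ) - 1) + t) / (r : ℤ)) :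
    (ℓ : ℚ) = ((p : ℚ) * (c : ℚ) * ((r : ℚ) - 1) + (t : ℚ)) / (r : ℚ) ∧
    (nu p ℓ (p - 1) : ℚ) ≤ (e : ℚ) + ((p : ℚ) - 1) / (r : ℚ) * ((r : ℚ) - 1) * (c : ℚ) ∧
    ((nu p ℓ (p - 1) : ℚ) = (e : ℚ) + ((p : ℚ) - 1) / (r : ℚ) * ((r : ℚ) - 1) * (c : ℚ) ↔
      (r : ℚ) * (p : ℚ) * (e : ℚ) / ((p : ℚ) - 1) - (r : ℚ) ≤ (t : ℚ)) := by
  obtain ⟨d, hd⟩ := hrp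
  have hpd : (p : ℤ) = r * d + 1 := by
    have : p = r * d + 1 := by omega
    exact_mod_cast this
  have hd0 : (0 : ℤ) < d := by
    rcases Nat.eq_zero_or_pos d with h | h
    · subst h; omega
    · exact_mod_cast h
  have hr' : (0 : ℤ) < r := by exact_mod_cast hr
  obtain ⟨m, hm⟩ : ∃ m : ℤ, t = r * m + c := ⟨t / r, by rw [hc]; exact (Int.mul_ediv_add_emod t r).symm⟩
  clear hc
  subst hm
  have hℓ' : ℓ = p * c - d * c + m := by
    rw [hℓ]
    refine Int.ediv_eq_of_eq_mul_right hr'.ne' ?_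
    rw [hpd]; ring
  have hpdQ : (p : ℚ) = r * d + 1 := by exact_mod_cast hpd
  have hrQ : (r : ℚ) ≠ 0 := by positivity
  have hp1 : (0 : ℚ) < (p : ℚ) - 1 := by
    have : (1 : ℚ) < p := by exact_mod_cast hp
    linarith
  have hpp : (0 : ℤ) < p := by omega
  -- The floor is of an integer: `ℓ % p + (p - 1) * ℓ = p * (ℓ - ℓ / p)`.
  have hnu : nu p ℓ (p - 1) = ℓ - ℓ / p := by
    rw [nu, Int.floor_eq_iff]
    have h1 := Int.emod_add_mul_ediv ℓ p
    have h2 : ((ℓ % p : ℤ) : ℚ) + ((p - 1 : ℕ) : ℚ) * ℓ = (ℓ - (ℓ / p : ℤ)) * p := by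
      have h3 : ((ℓ % p : ℤ) : ℚ) + p * (ℓ / p : ℤ) = ℓ := by exact_mod_cast h1
      rw [Nat.cast_sub hp.le]
      push_cast
      linear_combination h3
    rw [h2, mul_div_cancel_right₀ _ (by positivity)]
    push_cast
    constructor <;> linarith
  have hrhs : (e : ℚ) + ((p : ℚ) - 1) / r * ((r : ℚ) - 1) * c = ((e + d * (r - 1) * c : ℤ) : ℚ) := by
    rw [hpdQ]; push_cast; field_simp; ring
  have hcond : (r : ℚ) * p * e / ((p : ℚ) - 1) - r ≤ ((r * m + c : ℤ) : ℚ) ↔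
      (p : ℤ) * e ≤ d * (r * m + c) + d * r := by
    rw [sub_le_iff_le_add, div_le_iff₀ hp1]
    have : (p : ℚ) - 1 = r * d := by rw [hpdQ]; ring
    rw [this]
    have h3 : (r : ℚ) * p * e ≤ (((r * m + c : ℤ) : ℚ) + r) * (r * d) ↔
        (r : ℤ) * (p * e) ≤ r * (d * (r * m + c) + d * r) := by
      rw [← Int.cast_le (R := ℚ)]
      push_cast
      ring_nf
    rw [h3]
    exact mul_le_mul_iff_right₀ hr'
  have hbd : (d : ℤ) * (r * m + c) ≤ p * e := by
    have h4 : (r : ℤ) * (d * (r * m + c)) ≤ r * (p * e) := by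
      calc _ = ((p : ℤ) - 1) * (r * m + c) := by rw [hpd]; ring
        _ ≤ _ := ht
        _ = _ := by ring
    exact le_of_mul_le_mul_left h4 hr'
  have hdiv : ℓ / p = c + (m - d * c) / p := by
    rw [hℓ', show (p : ℤ) * c - d * c + m = (m - d * c) + p * c by ring,
      Int.add_mul_ediv_left _ _ hpp.ne', add_comm]
  have hle : m - e ≤ (m - d * c) / p := by
    rw [Int.le_ediv_iff_mul_le hpp]
    linear_combination hbd + m * hpd
  refine ⟨?_, ?_, ?_⟩
  · rw [hℓ', eq_div_iff hrQ]
    push_cast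
    rw [hpdQ]; ring
  · rw [hrhs, hnu, Int.cast_le, hdiv, hℓ']
    linear_combination hle + c * hpd
  · rw [hrhs, hnu, Int.cast_inj, hcond, hdiv, hℓ']
    -- Given `hle`, equality means the quotient stays below `m - e + 1`; the final `+ 1` comes from
    -- `p = r * d + 1` and turns strict into weak inequality.
    have h5 : (m - d * c) / p < m - e + 1 ↔ (p : ℤ) * e < d * (r * m + c) + d * r + 1 := by
      rw [Int.ediv_lt_iff_lt_mul hpp]
      have : (m - e + 1) * (p : ℤ) - (m - d * c) = d * (r * m + c) + d * r + 1 - p * e := by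
        linear_combination (m + 1) * hpd
      constructor <;> intro h <;> linarith
    have h6 : (p : ℤ) * c - d * c + m - (c + (m - d * c) / p) = e + d * (r - 1) * c ↔
        (m - d * c) / p = m - e := by
      constructor <;> intro h
      · linear_combination -h + c * hpd
      · linear_combination -h + c * hpd
    rw [h6, ← Int.lt_add_one_iff, ← h5]
    omega

end Arithmetic

/-! ### Galois group of the normal closure. -/

section NormalClosure

/-- The normal closure is generated by the roots of minimal polynomials of elements of `L`, and
these roots are Galois conjugates of such elements. -/
theorem eq_one_of_fixes_conjugates {K L M : Type*} [Field K] [Field L] [Field M] [Algebra K L]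
    [Algebra K M] [Algebra L M] [IsScalarTower K L M] [FiniteDimensional K L]
    (h : IsNormalClosure K L M) (τ : M ≃ₐ[K] M)
    (hτ : ∀ (g : M ≃ₐ[K] M) (x : L), τ (g (algebraMap L M x)) = g (algebraMap L M x)) :
    τ = 1 := by
  have := h.normal
  have htop : (⊤ : IntermediateField K M) ≤
      IntermediateField.fixedField (Subgroup.zpowers τ) := by
    rw [← h.adjoin_rootSet]
    refine iSup_le fun x => IntermediateField.adjoin_le_iff.mpr fun y hy => ?_
    have hx : IsIntegral K x := Algebra.IsIntegral.isIntegral x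
    have hy' := (Polynomial.mem_rootSet.mp hy).2
    rw [← minpoly.algebraMap_eq (algebraMap L M).injective x] at hy'
    obtain ⟨f, hf⟩ := minpoly.exists_algEquiv_of_root
      (hx.map (IsScalarTower.toAlgHom K L M)).isAlgebraic hy'
    obtain ⟨g, rfl⟩ : ∃ g : M ≃ₐ[K] M, g (algebraMap L M x) = y :=
      ⟨f.symm, f.symm_apply_eq.mpr hf.symm⟩
    rw [SetLike.mem_coe, IntermediateField.mem_fixedField_iff]
    intro f hf
    have : Subgroup.zpowers τ ≤ MulAction.stabilizer (M ≃ₐ[K] M) (g (algebraMap L M x)) := by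
      rw [Subgroup.zpowers_le]
      exact hτ g x
    exact this hf
  ext x
  exact (IntermediateField.mem_fixedField_iff _ _).mp (htop (IntermediateField.mem_top (x := x))) τ
    (Subgroup.mem_zpowers τ)

theorem finrank_dvd_pred_of_normal_subgroup {p : ℕ} (hp : p.Prime) {K L M : Type*} [Field K]
    [Field L] [Field M] [Algebra K L] [Algebra K M] [Algebra L M] [IsScalarTower K L M]
    [FiniteDimensional K M] [CharZero K] (hL : finrank K L = p) (h : IsNormalClosure K L M)
    (N : Subgroup (M ≃ₐ[K] M)) [N.Normal] (hN : Nat.card N = p) : finrank L M ∣ p - 1 := by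
  have := h.normal
  have : FiniteDimensional K L := FiniteDimensional.left K L M
  have : FiniteDimensional L M := FiniteDimensional.right K L M
  have : IsGalois K M := ⟨⟩
  have : IsGalois L M := IsGalois.tower_top_of_isGalois K L M
  have hfp : Fact p.Prime := ⟨hp⟩
  set ι : (M ≃ₐ[L] M) →* (M ≃ₐ[K] M) := AlgEquiv.restrictScalarsHom K with hι
  have hιa (σ : M ≃ₐ[L] M) (x : M) : ι σ x = σ x := rfl
  have hιinj : Function.Injective ι := AlgEquiv.restrictScalars_injective K
  have hcard : Nat.card ι.range = finrank L M := by
    rw [Nat.card_congr (MonoidHom.ofInjective hιinj).toEquiv.symm, IsGalois.card_aut_eq_finrank]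
  have hindex : ι.range.index = p := by
    have h1 := ι.range.card_mul_index
    rw [hcard, IsGalois.card_aut_eq_finrank, ← finrank_mul_finrank K L M, hL, mul_comm] at h1
    exact Nat.eq_of_mul_eq_mul_right finrank_pos h1
  -- A normal subgroup inside `Gal(M/L)` fixes every conjugate of `L`, hence is trivial.
  have hNle : ¬ N ≤ ι.range := by
    intro hle
    have hbot : N = ⊥ := by
      rw [eq_bot_iff]
      intro n hn
      rw [Subgroup.mem_bot]
      refine eq_one_of_fixes_conjugates h n fun g x => ?_
      have hconj : g⁻¹ * n * g ∈ N := by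
        simpa using Subgroup.Normal.conj_mem ‹N.Normal› n hn g⁻¹
      obtain ⟨σ, hσ⟩ := hle hconj
      have h2 : (g⁻¹ * n * g) (algebraMap L M x) = algebraMap L M x := by
        rw [← hσ, hιa, AlgEquiv.commutes]
      have h3 := congrArg g h2
      rw [← AlgEquiv.mul_apply, ← mul_assoc, mul_inv_cancel_left] at h3
      exact h3
    rw [hbot, Subgroup.card_bot] at hN
    exact hp.one_lt.ne hN
  have hsup : N ⊔ ι.range = ⊤ := by
    have h1 : ι.range ≤ N ⊔ ι.range := le_sup_right
    have h2 := Subgroup.relIndex_mul_index h1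
    rw [hindex] at h2
    rcases (Nat.dvd_prime hp).mp ⟨_, h2.symm.trans (mul_comm _ _)⟩ with h3 | h3
    · exact Subgroup.index_eq_one.mp h3
    · rw [h3] at h2
      have h4 : ι.range.relIndex (N ⊔ ι.range) = 1 :=
        Nat.eq_of_mul_eq_mul_right hp.pos (by rw [h2, one_mul])
      exact absurd (le_sup_left.trans (Subgroup.relIndex_eq_one.mp h4)) hNle
  set φ : (M ≃ₐ[L] M) →* MulAut N := MulAut.conjNormal.comp ι with hφ
  have hφinj : Function.Injective φ := by
    rw [injective_iff_map_eq_one]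
    intro σ hσ
    have hcomm (n : M ≃ₐ[K] M) (hn : n ∈ N) : ι σ * n = n * ι σ := by
      have h1 : ((φ σ ⟨n, hn⟩ : N) : M ≃ₐ[K] M) = n := by rw [hσ]; rfl
      rw [hφ, MonoidHom.comp_apply, MulAut.conjNormal_apply] at h1
      exact mul_inv_eq_iff_eq_mul.mp h1
    refine hιinj ?_
    rw [map_one]
    -- Since `G = N H`, every conjugate of `x ∈ L` is `n x` with `n ∈ N`, and an element of `H`
    -- commuting with `n` fixes it.
    refine eq_one_of_fixes_conjugates h _ fun g x => ?_
    obtain ⟨n, hn, _, ⟨τ, rfl⟩, rfl⟩ : ∃ n ∈ N, ∃ k ∈ ι.range, n * k = g := by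
      have : g ∈ N ⊔ ι.range := hsup ▸ Subgroup.mem_top g
      rwa [← SetLike.mem_coe, Subgroup.normal_mul, Set.mem_mul] at this
    have h1 : (n * ι τ) (algebraMap L M x) = n (algebraMap L M x) := by
      rw [AlgEquiv.mul_apply, hιa, AlgEquiv.commutes]
    rw [h1, ← AlgEquiv.mul_apply, hcomm n hn, AlgEquiv.mul_apply, hιa, AlgEquiv.commutes]
  have : IsCyclic N := isCyclic_of_prime_card hN
  have hdvd := Subgroup.card_dvd_of_injective φ hφinj
  rwa [IsGalois.card_aut_eq_finrank, IsCyclic.card_mulAut, hN, Nat.totient_prime hp] at hdvd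

end NormalClosure

/-! ### The ring of integers is a discrete valuation ring. -/

section RingOfIntegers

variable (p : ℕ) [Fact p.Prime] (F : Type*) [Field F] [Algebra ℚ_[p] F]
  [FiniteDimensional ℚ_[p] F]

theorem spectralNorm_mul_eq (x y : F) :
    spectralNorm ℚ_[p] F (x * y) = spectralNorm ℚ_[p] F x * spectralNorm ℚ_[p] F y :=
  map_mul (spectralMulAlgNorm ℚ_[p] F) x y

/-- The norm of `x` is a `deg`-th root of the norm of the constant coefficient of its minimal
polynomial, and `deg` divides the degree of `F`. This gives discreteness of the value group. -/
theorem exists_spectralNorm_pow_finrank_eq_zpow {x : F} (hx : x ≠ 0) :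
    ∃ k : ℤ, spectralNorm ℚ_[p] F x ^ finrank ℚ_[p] F = (p : ℝ) ^ (-k) := by
  have hint : IsIntegral ℚ_[p] x := Algebra.IsIntegral.isIntegral x
  have h0 : (minpoly ℚ_[p] x).coeff 0 ≠ 0 := minpoly.coeff_zero_ne_zero hint hx
  obtain ⟨m, hm⟩ : (minpoly ℚ_[p] x).natDegree ∣ finrank ℚ_[p] F := minpoly.degree_dvd hint
  have hk := Padic.norm_eq_zpow_neg_valuation h0
  set k := ((minpoly ℚ_[p] x).coeff 0).valuation
  refine ⟨k * m, ?_⟩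
  have hd : (minpoly ℚ_[p] x).natDegree ≠ 0 := (minpoly.natDegree_pos hint).ne'
  rw [hm, pow_mul, spectralNorm.spectralNorm_eq_norm_coeff_zero_rpow, one_div,
    Real.rpow_inv_natCast_pow (norm_nonneg _) hd, hk, ← zpow_natCast, ← zpow_mul]
  ring_nf

theorem exists_spectralNorm_pow_finrank_eq_inv_pow (x : ringOfIntegers p F) (hx : x ≠ 0) :
    ∃ k : ℕ, spectralNorm ℚ_[p] F x ^ finrank ℚ_[p] F = ((p : ℝ) ^ k)⁻¹ := by
  obtain ⟨k, hk⟩ := exists_spectralNorm_pow_finrank_eq_zpow p F (x := x) (by simpa using hx)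
  have hp : (1 : ℝ) < p := by exact_mod_cast (Fact.out : p.Prime).one_lt
  have h1 : spectralNorm ℚ_[p] F x ^ finrank ℚ_[p] F ≤ 1 :=
    pow_le_one₀ (spectralNorm_nonneg _) ((mem_ringOfIntegers p F x).mp x.2)
  rw [hk, zpow_le_one_iff_right₀ hp, neg_nonpos] at h1
  lift k to ℕ using h1
  exact ⟨k, by rw [hk, zpow_neg, zpow_natCast]⟩

theorem isUnit_of_spectralNorm_eq_one (x : ringOfIntegers p F)
    (hx : spectralNorm ℚ_[p] F x = 1) : IsUnit x := by
  have hx0 : (x : F) ≠ 0 := by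
    intro h
    rw [h, spectralNorm_zero] at hx
    exact zero_ne_one hx
  have hinv : spectralNorm ℚ_[p] F (x : F)⁻¹ = 1 := by
    have := spectralNorm_mul_eq p F (x : F) (x : F)⁻¹
    rw [mul_inv_cancel₀ hx0, hx, one_mul, spectralNorm_one] at this
    exact this.symm
  exact IsUnit.of_mul_eq_one ⟨(x : F)⁻¹, (mem_ringOfIntegers p F _).mpr hinv.le⟩
    (Subtype.ext (mul_inv_cancel₀ hx0))

/-- Proper divisibility strictly increases the natural exponent `k`, with zero sent to `⊤`. -/
instance : WfDvdMonoid (ringOfIntegers p F) := by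
  have hp : (1 : ℝ) < p := by exact_mod_cast (Fact.out : p.Prime).one_lt
  choose! k hk using exists_spectralNorm_pow_finrank_eq_inv_pow p F
  let f : ringOfIntegers p F → ℕ∞ := fun x => open Classical in if x = 0 then ⊤ else k x
  refine ⟨Subrelation.wf (r := InvImage (· < ·) f) ?_ (InvImage.wf f wellFounded_lt)⟩
  rintro a b ⟨ha, u, hu, rfl⟩
  simp only [InvImage, f, if_neg ha]
  split_ifs with hb
  · exact ENat.natCast_lt_top _
  · have hlt : spectralNorm ℚ_[p] F u < 1 :=
      lt_of_le_of_ne ((mem_ringOfIntegers p F u).mp u.2)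
        fun h => hu (isUnit_of_spectralNorm_eq_one p F u h)
    have hpos : 0 < spectralNorm ℚ_[p] F a :=
      spectralNorm_zero_lt (by simpa using ha) (Algebra.IsAlgebraic.isAlgebraic _)
    have h1 : spectralNorm ℚ_[p] F (a * u : ringOfIntegers p F) < spectralNorm ℚ_[p] F a := by
      rw [show ((a * u : ringOfIntegers p F) : F) = a * u from rfl, spectralNorm_mul_eq]
      exact mul_lt_of_lt_one_right hpos hlt
    have h2 := pow_lt_pow_left₀ h1 (spectralNorm_nonneg _) (finrank_pos (R := ℚ_[p]) (M := F)).ne'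
    rw [hk _ ha, hk _ hb, inv_lt_inv₀ (by positivity) (by positivity),
      pow_lt_pow_iff_right₀ hp] at h2
    exact_mod_cast h2

theorem natCast_prime_ne_zero : (p : ringOfIntegers p F) ≠ 0 := by
  intro h
  have h2 : algebraMap ℚ_[p] F p = 0 := by
    rw [map_natCast]
    exact congrArg Subtype.val h
  rw [map_eq_zero] at h2
  exact (Fact.out : p.Prime).ne_zero (by exact_mod_cast h2)

omit [FiniteDimensional ℚ_[p] F] in
theorem spectralNorm_natCast_prime : spectralNorm ℚ_[p] F (p : F) = (p : ℝ)⁻¹ := by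
  rw [← map_natCast (algebraMap ℚ_[p] F), spectralNorm_extends, Padic.norm_p]

theorem not_isUnit_natCast_prime : ¬ IsUnit (p : ringOfIntegers p F) := by
  have hp : (1 : ℝ) < p := by exact_mod_cast (Fact.out : p.Prime).one_lt
  intro h
  obtain ⟨u, hu⟩ := h.exists_right_inv
  have h1 : (p : F) * u = 1 := by
    have := congrArg (Subtype.val) hu
    simpa using this
  have h2 := spectralNorm_mul_eq p F (p : F) u
  rw [h1, spectralNorm_one, spectralNorm_natCast_prime] at h2
  have h3 := mul_le_mul_of_nonneg_left ((mem_ringOfIntegers p F u).mp u.2)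
    (inv_nonneg.mpr (zero_le_one.trans hp.le))
  rw [← h2, mul_one] at h3
  exact absurd h3 (not_le.mpr (inv_lt_one_of_one_lt₀ hp))

instance : IsDiscreteValuationRing (ringOfIntegers p F) := by
  have hpir : IsPrincipalIdealRing (ringOfIntegers p F) :=
    ((IsBezout.TFAE (R := ringOfIntegers p F)).out 1 3).mpr (inferInstance : WfDvdMonoid _)
  refine { not_a_field' := fun h => natCast_prime_ne_zero p F ?_ }
  rw [← Ideal.mem_bot, ← h]
  exact (mem_maximalIdeal _).mpr (not_isUnit_natCast_prime p F)

end RingOfIntegers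

/-! ### Ramification indices as valuations, and their multiplicativity. -/

section RamificationIndex

variable (p : ℕ) [Fact p.Prime]

theorem dvd_natCast_prime_of_mem_maximalIdeal {x : ringOfIntegers p ℚ_[p]}
    (hx : x ∈ maximalIdeal (ringOfIntegers p ℚ_[p])) : (p : ringOfIntegers p ℚ_[p]) ∣ x := by
  have hn (y : ℚ_[p]) : spectralNorm ℚ_[p] ℚ_[p] y = ‖y‖ := spectralNorm_extends y
  have hp0 : (p : ℚ_[p]) ≠ 0 := by exact_mod_cast (Fact.out : p.Prime).ne_zero
  have h1 : ‖(x : ℚ_[p])‖ < 1 := by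
    rw [← hn]
    refine lt_of_le_of_ne ((mem_ringOfIntegers p ℚ_[p] x).mp x.2) fun h => ?_
    exact (mem_maximalIdeal x).mp hx (isUnit_of_spectralNorm_eq_one p ℚ_[p] x h)
  have h2 : ‖(x : ℚ_[p])‖ ≤ (p : ℝ)⁻¹ := by
    have := (Padic.norm_le_pow_iff_norm_lt_pow_add_one (x : ℚ_[p]) (-1)).mpr (by simpa using h1)
    simpa using this
  have h3 : (p : ℚ_[p])⁻¹ * (x : ℚ_[p]) ∈ ringOfIntegers p ℚ_[p] := by
    rw [mem_ringOfIntegers, hn, norm_mul, norm_inv, Padic.norm_p, inv_inv]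
    have hp : (0 : ℝ) < p := by exact_mod_cast (Fact.out : p.Prime).pos
    calc _ ≤ (p : ℝ) * (p : ℝ)⁻¹ := by gcongr
      _ = 1 := mul_inv_cancel₀ hp.ne'
  refine ⟨⟨_, h3⟩, Subtype.ext ?_⟩
  change (x : ℚ_[p]) = (p : ℚ_[p]) * ((p : ℚ_[p])⁻¹ * (x : ℚ_[p]))
  rw [mul_inv_cancel_left₀ hp0]

variable (K F : Type*) [Field K] [Field F] [Algebra ℚ_[p] K] [FiniteDimensional ℚ_[p] K]
  [Algebra ℚ_[p] F] [FiniteDimensional ℚ_[p] F] [Algebra K F] [IsScalarTower ℚ_[p] K F]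

theorem integersMap_injective : Function.Injective (integersMap p K F) := fun _ _ h =>
  Subtype.ext ((algebraMap K F).injective (congrArg Subtype.val h))

theorem addVal_integersMap_eq_ramificationIndex {x : ringOfIntegers p K}
    (hx : maximalIdeal (ringOfIntegers p K) = Ideal.span {x}) :
    IsDiscreteValuationRing.addVal (ringOfIntegers p F) (integersMap p K F x) =
      ramificationIndex p K F := by
  have hx0 : x ≠ 0 := by
    rintro rfl
    rw [Ideal.span_singleton_zero] at hx
    exact IsDiscreteValuationRing.not_a_field _ hx
  obtain ⟨n, hn⟩ := ENat.ne_top_iff_exists.mp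
    (IsDiscreteValuationRing.addVal_eq_top_iff.not.mpr
      ((map_ne_zero_iff _ (integersMap_injective p K F)).mpr hx0))
  let _ : Algebra (ringOfIntegers p K) (ringOfIntegers p F) := (integersMap p K F).toAlgebra
  have hle (m : ℕ) : Ideal.map (algebraMap (ringOfIntegers p K) (ringOfIntegers p F))
      (maximalIdeal (ringOfIntegers p K)) ≤ maximalIdeal (ringOfIntegers p F) ^ m ↔ m ≤ n := by
    rw [hx, Ideal.map_span, Set.image_singleton, Ideal.span_singleton_le_iff_mem,
      mem_maximalIdeal_pow_iff_le_addVal, ← Nat.cast_le (α := ℕ∞), hn]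
    rfl
  rw [← hn, Nat.cast_inj]
  exact (Ideal.ramificationIdx'_spec ((hle n).mpr le_rfl) (by rw [hle]; omega)).symm

theorem addVal_natCast_prime_eq_ramificationIndex :
    IsDiscreteValuationRing.addVal (ringOfIntegers p F) (p : ringOfIntegers p F) =
      ramificationIndex p ℚ_[p] F := by
  rw [← addVal_integersMap_eq_ramificationIndex p ℚ_[p] F (x := (p : ringOfIntegers p ℚ_[p])),
    map_natCast (integersMap p ℚ_[p] F)]
  refine le_antisymm (fun x hx => ?_) ?_
  · exact Ideal.mem_span_singleton.mpr (dvd_natCast_prime_of_mem_maximalIdeal p hx)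
  · rw [Ideal.span_singleton_le_iff_mem]
    exact (mem_maximalIdeal _).mpr (not_isUnit_natCast_prime p ℚ_[p])

theorem ramificationIndex_tower :
    ramificationIndex p ℚ_[p] F = ramificationIndex p ℚ_[p] K * ramificationIndex p K F := by
  obtain ⟨ϖ, hϖ⟩ := IsDiscreteValuationRing.exists_irreducible (ringOfIntegers p K)
  rw [← Nat.cast_inj (R := ℕ∞), Nat.cast_mul, ← addVal_natCast_prime_eq_ramificationIndex,
    ← addVal_natCast_prime_eq_ramificationIndex,
    ← addVal_integersMap_eq_ramificationIndex p K F hϖ.maximalIdeal_eq,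
    ← addVal_map_eq_mul (integersMap p K F) hϖ (natCast_prime_ne_zero p K),
    map_natCast (integersMap p K F)]

end RamificationIndex

/-! ### Ramification groups and the bound on the jump. -/

section RamificationGroup

variable (p : ℕ) [Fact p.Prime] (K F : Type*) [Field K] [Field F] [Algebra ℚ_[p] K]
  [Algebra ℚ_[p] F] [FiniteDimensional ℚ_[p] F] [Algebra K F] [IsScalarTower ℚ_[p] K F]

theorem mem_ramificationGroup (i : ℤ) (σ : F ≃ₐ[K] F) : σ ∈ ramificationGroup p K F i ↔
    ∀ x : ringOfIntegers p F, σ • x - x ∈ maximalIdeal (ringOfIntegers p F) ^ (i + 1).toNat :=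
  Iff.rfl

instance (i : ℤ) : (ramificationGroup p K F i).Normal where
  conj_mem σ hσ τ := by
    rw [mem_ramificationGroup] at hσ ⊢
    intro x
    have := smul_mem_maximalIdeal_pow τ (hσ (τ⁻¹ • x))
    rwa [smul_sub, smul_inv_smul, ← mul_smul, ← mul_smul] at this

variable {p K F} in
theorem IsRamificationJump.card_eq {t : ℤ} (ht : IsRamificationJump p K F t) :
    Nat.card (ramificationGroup p K F t) = p := by
  obtain ⟨⟨φ⟩, -⟩ := ht
  rw [Nat.card_congr φ.toEquiv, Nat.card_congr Multiplicative.toAdd, Nat.card_zmod]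

/-- The classical bound `t ≤ e / (p - 1)` for a ramification break `t`. -/
theorem IsRamificationJump.mul_le {t : ℤ} (ht : IsRamificationJump p K F t) :
    ((p : ℤ) - 1) * t ≤ ramificationIndex p ℚ_[p] F := by
  have hp : p.Prime := Fact.out
  rcases le_or_gt t 0 with h0 | h0
  · have hp1 : (0 : ℤ) ≤ (p : ℤ) - 1 := by have := hp.one_lt; omega
    exact (mul_nonpos_of_nonneg_of_nonpos hp1 h0).trans (by positivity)
  lift t to ℕ using h0.le
  have hcard := ht.card_eq
  have : Finite (ramificationGroup p K F t) :=
    Nat.finite_of_card_ne_zero (by rw [hcard]; exact hp.ne_zero)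
  have hnt : Nontrivial (ramificationGroup p K F t) :=
    Finite.one_lt_card_iff_nontrivial.mp (by rw [hcard]; exact hp.one_lt)
  obtain ⟨σ, hσ⟩ := exists_ne (1 : ramificationGroup p K F t)
  have hσp : (σ : F ≃ₐ[K] F) ^ p = 1 := by
    have h1 : σ ^ Nat.card (ramificationGroup p K F t) = 1 := pow_card_eq_one'
    rw [hcard] at h1
    exact congrArg Subtype.val h1
  -- Every element of `F` or its inverse is integral, so an automorphism fixing all integers is
  -- trivial.
  have hmoves : ∃ x : ringOfIntegers p F, (σ : F ≃ₐ[K] F) • x ≠ x := by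
    by_contra! h
    refine hσ (Subtype.ext (AlgEquiv.ext fun x => ?_))
    rcases (ringOfIntegers p F).mem_or_inv_mem x with hx | hx
    · exact congrArg Subtype.val (h ⟨x, hx⟩)
    · have h1 : (σ : F ≃ₐ[K] F) x⁻¹ = x⁻¹ := congrArg Subtype.val (h ⟨x⁻¹, hx⟩)
      rw [map_inv₀] at h1
      exact inv_injective h1
  have hle := mul_le_addVal_natCast hp (R := ringOfIntegers p F) (by exact_mod_cast h0) hσp
    (by simpa using (mem_ramificationGroup p K F t σ).mp σ.2) hmoves
  rw [addVal_natCast_prime_eq_ramificationIndex, Nat.cast_le] at hle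
  have := Nat.cast_le (α := ℤ) |>.mpr hle
  rwa [Nat.cast_mul, Nat.cast_pred hp.pos] at this

end RamificationGroup

end PadicExt

theorem mainTheorem8 (p : ℕ) [Fact p.Prime] (hp : Odd p)
    (K L Lt : Type*) [Field K] [Field L] [Field Lt]
    [Algebra ℚ_[p] K] [FiniteDimensional ℚ_[p] K]
    [Algebra ℚ_[p] Lt] [FiniteDimensional ℚ_[p] Lt]
    [Algebra K L] [Algebra K Lt] [Algebra L Lt] [IsScalarTower K L Lt] [IsScalarTower ℚ_[p] K Lt]
    (htypical : PadicExt.IsTypical p K L)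
    (hclosure : IsNormalClosure K L Lt)
    (htotram : PadicExt.IsTotallyRamified p K Lt)
    (e : ℕ) (he : e = PadicExt.ramificationIndex p ℚ_[p] K)
    (r : ℕ) (hr : r = Module.finrank L Lt)
    (t : ℤ) (ht : PadicExt.IsRamificationJump p K Lt t)
    (c : ℤ) (hc : c = t % (r : ℤ))
    (ℓ : ℤ) (hℓ : ℓ = ((p : ℤ) * c * ((r : ℤ) - 1) + t) / (r : ℤ)) :
    -- the integer division defining `ℓ` is exact
    (ℓ : ℚ) = ((p : ℚ) * (c : ℚ) * ((r : ℚ) - 1) + (t : ℚ)) / (r : ℚ) ∧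
    (PadicExt.nu p ℓ (p - 1) : ℚ) ≤ (e : ℚ) + ((p : ℚ) - 1) / (r : ℚ) * ((r : ℚ) - 1) * (c : ℚ) ∧
    ((PadicExt.nu p ℓ (p - 1) : ℚ) = (e : ℚ) + ((p : ℚ) - 1) / (r : ℚ) * ((r : ℚ) - 1) * (c : ℚ) ↔
      (r : ℚ) * (p : ℚ) * (e : ℚ) / ((p : ℚ) - 1) - (r : ℚ) ≤ (t : ℚ)) := by
  have hp1 : p.Prime := Fact.out
  have : FiniteDimensional K Lt := FiniteDimensional.right ℚ_[p] K Lt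
  have : FiniteDimensional L Lt := FiniteDimensional.right K L Lt
  have : CharZero K := charZero_of_injective_algebraMap (algebraMap ℚ_[p] K).injective
  have hdvd : r ∣ p - 1 := by
    rw [hr]
    exact PadicExt.finrank_dvd_pred_of_normal_subgroup hp1 htypical.1 hclosure _ ht.card_eq
  have hindex : PadicExt.ramificationIndex p ℚ_[p] Lt = p * (r * e) := by
    have htr : PadicExt.ramificationIndex p K Lt = finrank K Lt := htotram
    rw [PadicExt.ramificationIndex_tower p K Lt, htr, ← finrank_mul_finrank K L Lt, htypical.1,
      ← hr, ← he]
    ring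
  have hbound := PadicExt.IsRamificationJump.mul_le p K Lt ht
  rw [hindex] at hbound
  push_cast at hbound
  exact PadicExt.floor_bound_of_dvd hp1.one_lt (hr ▸ finrank_pos) hdvd hbound hc hℓ
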